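/- Let $n,m\ge 0$ and $k\ge 1$ be integers, let $f_1,\dots,f_m\in\mathbb{R}[x_1,\dots,x_n]$, let $\rho_1,\dots,\rho_{2k}\in\mathbb{Q}$ (repetitions allowed), and put $$D_{2k}(x)=\prod_{l=1}^{2k}(x-\rho_l)=x^{2k}+\alpha_{2k-1}x^{2k-1}+\dots+\alpha_0 ,\qquad \mathcal F=\{f_i=0 : i\in[m]\},\qquad \mathcal D=\{D_{2k}(x_j)=0 : j\in[n]\}.$$ Let $\beta$ be the minimum number of bits with which each of the rational numbers $\alpha_0,\dots,\alpha_{2k-1},\rho_1,\dots,\rho_{2k}$ can be encoded (reduced fractions, written in binary). A PC (polynomial calculus) derivation from $\mathcal F\cup\mathcal D$ is a sequence $(r_1,\dots,r_L)$ of polynomials each of which is some $f_i$, or some $D_{2k}(x_j)$, or $a\,r_{H_1}+b\,r_{H_2}$ with $a,b\in\mathbb{R}$ and earlier lines $r_{H_1},r_{H_2}$, or $x_j\,r_{H_1}$ with an earlier line $r_{H_1}$. Its degree is the maximum degree of its lines. If all its lines have rational coefficients, its size is the sum of the lengths of the binary encodings of its lines (each polynomial is encoded as the list of its nonzero terms,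 coefficients as reduced fractions). Claim. There are a polynomial $B\in\mathbb{N}[y_1,y_2,y_3]$ and a constant $K$, both universal, such that the following holds for all data as above. Let $(r_1,\dots,r_L)$ be a PC derivation from $\mathcal F\cup\mathcal D$ of degree $d$ and size $S$, with rational coefficients in all lines. Then for every $H\le L$ there is an identity $$\sum_{i=1}^m (-a_i f_i)\,f_i+\sum_{j=1}^n q_j\,D_{2k}(x_j)+\sum_{j=1}^{m_1}c_j\,p_j^2=-r_H^2$$ such that - $m_1\le K\,k\,H$; - the $a_i$ and $c_j$ are nonnegative rational numbers, the $q_j$ and $p_j$ are polynomials with rational coefficients, and the multipliers $-a_i f_i$ also have rational coefficients; - it is an SoS proof of $-r_H^2\ge 0$ from $\mathcal F\cup\mathcal D$ of degree at most $2(d+k-1)$: each of the polynomials $a_i f_i^2$, $q_jD_{2k}(x_j)$, $c_jp_j^2$ has degree at most $2(d+k-1)$; - all $c_j$, all nonzero $a_i$ and all nonzero coefficients of the polynomials $-a_if_i$, $q_j$, $p_j$ can be encoded together with at most $B(k,\beta,S)$ bits. -/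

import Mathlib

open MvPolynomial

noncomputable section

namespace PCSoS

/-- A polynomial with rational coefficients, seen in the real polynomial ring. -/
abbrev toReal {n : ℕ} (p : MvPolynomial (Fin n) ℚ) : MvPolynomial (Fin n) ℝ :=
  MvPolynomial.map (algebraMap ℚ ℝ) p

/-! ### Domain polynomials -/

/-- The domain axiom `(x_j - ρ_1)(x_j - ρ_2) ⋯ (x_j - ρ_N)` for the variable `x_j`. -/
def domainAxiom {n N : ℕ} (ρ : Fin N → ℚ) (j : Fin n) : MvPolynomial (Fin n) ℝ :=
  ∏ i : Fin N, (X j - C (ρ i : ℝ))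

/-- The number `α_i`: the coefficient of `x ^ i` in the univariate domain polynomial
`(x - ρ_1)(x - ρ_2) ⋯ (x - ρ_N)`. -/
def domainCoeff {N : ℕ} (ρ : Fin N → ℚ) (i : ℕ) : ℚ :=
  (∏ l : Fin N, (Polynomial.X - Polynomial.C (ρ l))).coeff i

/-! ### Bit lengths -/

/-- Bit length of a rational number, written as a reduced fraction in binary:
numerator, denominator and sign. -/
def ratBits (q : ℚ) : ℕ := q.num.natAbs.size + q.den.size + 1

/-- Bit length of a monomial, written as the list of its variables (their indices in binary,
with a separator bit) together with their exponents in binary. -/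
def monoBits {n : ℕ} (s : Fin n →₀ ℕ) : ℕ :=
  ∑ i ∈ s.support, ((i : ℕ).size + (s i).size + 1)

/-- Size of a polynomial: length of the binary encoding of the list of its terms
(one extra bit marks the end of the list, so that the zero polynomial has size `1`). -/
def polySize {n : ℕ} (p : MvPolynomial (Fin n) ℚ) : ℕ :=
  (∑ s ∈ p.support, (ratBits (p.coeff s) + monoBits s)) + 1

/-- Number of bits that encode all the (nonzero) coefficients of a polynomial together. -/
def coeffBits {n : ℕ} (p : MvPolynomial (Fin n) ℚ) : ℕ :=
  ∑ s ∈ p.support, ratBits (p.coeff s)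

/-- The number `β`: the least number of bits with which each of the coefficients
`α_0, …, α_{N-1}` of the domain polynomial and each of the values `ρ_1, …, ρ_N`
can be encoded. -/
def domainBits {N : ℕ} (ρ : Fin N → ℚ) : ℕ :=
  max ((Finset.range N).sup fun i => ratBits (domainCoeff ρ i))
    (Finset.univ.sup fun l => ratBits (ρ l))

/-! ### Polynomial calculus over a finite domain -/

/-- `r = (r_1, …, r_L)` is a PC derivation from the axioms `f_i = 0` and the domain axioms:
every line is one of the `f_i`, or a domain axiom, or a real linear combination of two earlier
lines, or the product of a variable and an earlier line. -/
def IsPCDerivation {n m N L : ℕ} (f : Fin m → MvPolynomial (Fin n) ℝ) (ρ : Fin N → ℚ)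
    (r : Fin L → MvPolynomial (Fin n) ℝ) : Prop :=
  ∀ h : Fin L,
    (∃ i, r h = f i) ∨
    (∃ j, r h = domainAxiom ρ j) ∨
    (∃ h₁ h₂, h₁ < h ∧ h₂ < h ∧ ∃ a b : ℝ, r h = C a * r h₁ + C b * r h₂) ∨
    (∃ h₁, h₁ < h ∧ ∃ j, r h = X j * r h₁)

/-- Degree of a derivation: the maximum degree of its lines. -/
def pcDegree {n L : ℕ} (r : Fin L → MvPolynomial (Fin n) ℚ) : ℕ :=
  Finset.univ.sup fun h => (r h).totalDegree

/-- Size of a derivation: the sum of the sizes of its lines. -/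
def pcSize {n L : ℕ} (r : Fin L → MvPolynomial (Fin n) ℚ) : ℕ :=
  ∑ h, polySize (r h)

/-! ### Sum-of-squares proofs -/

/-- The squares of the `s_i` and the multipliers `h_i` form an SoS proof of `g ≥ 0` from
`{P_i = 0}` of degree at most `D`. -/
def IsSoSProof {n t : ℕ} {ι : Type*} [Fintype ι] (P : ι → MvPolynomial (Fin n) ℝ)
    (g : MvPolynomial (Fin n) ℝ) (D : ℕ)
    (s : Fin t → MvPolynomial (Fin n) ℝ) (h : ι → MvPolynomial (Fin n) ℝ) : Prop :=
  g = ∑ i, s i ^ 2 + ∑ i, h i * P i ∧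
  (∀ i, (s i ^ 2).totalDegree ≤ D) ∧
  (∀ i, (h i * P i).totalDegree ≤ D)

/-- Number of bits that encode all the coefficients of a proof of the form
`∑ (-a_i f_i) f_i + ∑ q_j D(x_j) + ∑ c_j (p_j)^2` together, where `g_i` is the multiplier
`-a_i f_i`. As in a list of terms, those `a_i` and those coefficients of polynomials that
vanish are not written down. -/
def proofBits {n m m₁ : ℕ} (a : Fin m → ℚ) (g : Fin m → MvPolynomial (Fin n) ℚ)
    (q : Fin n → MvPolynomial (Fin n) ℚ) (c : Fin m₁ → ℚ)
    (p : Fin m₁ → MvPolynomial (Fin n) ℚ) : ℕ :=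
  (∑ i with a i ≠ 0, ratBits (a i)) + (∑ i, coeffBits (g i)) + (∑ j, coeffBits (q j)) +
    (∑ j, ratBits (c j)) + (∑ j, coeffBits (p j))

end PCSoS

end

namespace PCSoS

/-- The rational number `q` has height at most `2 ^ t`. -/
def HtLE (q : ℚ) (t : ℕ) : Prop := q.num.natAbs + q.den ≤ 2 ^ t

theorem HtLE.of_div {q : ℚ} {a : ℤ} {b t : ℕ} (hb : b ≠ 0) (hq : q = a / b)
    (h : a.natAbs + b ≤ 2 ^ t) : HtLE q t := by
  have hb' : (b : ℤ) ≠ 0 := by exact_mod_cast hb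
  have e : q = Rat.divInt a b := by rw [hq, Rat.divInt_eq_div]; simp
  unfold HtLE
  refine le_trans (add_le_add ?_ ?_) h
  · by_cases ha : a = 0
    · simp [e, ha]
    · have := Rat.num_dvd a hb'
      rw [← e] at this
      exact Nat.le_of_dvd (Int.natAbs_pos.mpr ha) (Int.natAbs_dvd_natAbs.mpr this)
  · have := Rat.den_dvd a b
    rw [← e] at this
    exact Nat.le_of_dvd (Nat.pos_of_ne_zero hb) (by exact_mod_cast this)

theorem HtLE.mono {q : ℚ} {t t' : ℕ} (h : HtLE q t) (htt : t ≤ t') : HtLE q t' :=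
  le_trans h (Nat.pow_le_pow_right (by norm_num) htt)

theorem HtLE.zero (t : ℕ) : HtLE 0 t := by
  simp [HtLE, Nat.one_le_two_pow]

theorem HtLE.natCast {N t : ℕ} (h : N + 1 ≤ 2 ^ t) : HtLE (N : ℚ) t := by
  simpa [HtLE] using h

theorem HtLE.one {t : ℕ} (ht : 1 ≤ t) : HtLE 1 t := by
  have : HtLE ((1 : ℕ) : ℚ) 1 := HtLE.natCast (by norm_num)
  simpa using this.mono ht

theorem HtLE.neg {q : ℚ} {t : ℕ} (h : HtLE q t) : HtLE (-q) t := by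
  simpa [HtLE] using h

theorem HtLE.mul {x y : ℚ} {t u : ℕ} (hx : HtLE x t) (hy : HtLE y u) :
    HtLE (x * y) (t + u) := by
  refine HtLE.of_div (a := x.num * y.num) (b := x.den * y.den)
    (mul_ne_zero x.den_nz y.den_nz) ?_ ?_
  · push_cast
    rw [mul_div_mul_comm, Rat.num_div_den, Rat.num_div_den]
  · rw [Int.natAbs_mul, pow_add]
    refine le_trans ?_ (Nat.mul_le_mul hx hy)
    nlinarith [Nat.zero_le (x.num.natAbs * y.den), Nat.zero_le (x.den * y.num.natAbs)]

theorem HtLE.add {x y : ℚ} {t u : ℕ} (hx : HtLE x t) (hy : HtLE y u) :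
    HtLE (x + y) (t + u) := by
  have h1 : (x.den : ℚ) ≠ 0 := by exact_mod_cast x.den_nz
  have h2 : (y.den : ℚ) ≠ 0 := by exact_mod_cast y.den_nz
  refine HtLE.of_div (a := x.num * y.den + x.den * y.num) (b := x.den * y.den)
    (mul_ne_zero x.den_nz y.den_nz) ?_ ?_
  · push_cast
    rw [← div_add_div _ _ h1 h2, Rat.num_div_den, Rat.num_div_den]
  · rw [pow_add]
    refine le_trans (Nat.add_le_add_right (Int.natAbs_add_le _ _) _)
      (le_trans ?_ (Nat.mul_le_mul hx hy))
    simp only [Int.natAbs_mul, Int.natAbs_natCast]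
    nlinarith [Nat.zero_le (x.num.natAbs * y.num.natAbs)]

theorem HtLE.sub {x y : ℚ} {t u : ℕ} (hx : HtLE x t) (hy : HtLE y u) :
    HtLE (x - y) (t + u) := by
  rw [sub_eq_add_neg]; exact hx.add hy.neg

theorem HtLE.inv {x : ℚ} {t : ℕ} (hx : HtLE x t) : HtLE x⁻¹ t := by
  by_cases h0 : x = 0
  · subst h0; simpa using hx
  have hn : x.num ≠ 0 := Rat.num_ne_zero.mpr h0
  refine HtLE.of_div (a := x.num.sign * x.den) (b := x.num.natAbs)
    (Int.natAbs_ne_zero.mpr hn) ?_ ?_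
  · have h : (x.num : ℚ) = x.num.sign * x.num.natAbs := by
      have := congrArg (Int.cast : ℤ → ℚ) (Int.sign_mul_natAbs x.num)
      rw [Int.cast_mul, Int.cast_natCast] at this
      exact this.symm
    have hs : (x.num.sign : ℚ) * x.num.sign = 1 := by
      rcases lt_or_gt_of_ne hn with h | h
      · simp [Int.sign_eq_neg_one_of_neg h]
      · simp [Int.sign_eq_one_of_pos h]
    have hN : (x.num.natAbs : ℚ) ≠ 0 := by exact_mod_cast Int.natAbs_ne_zero.mpr hn
    have hd : (x.den : ℚ) ≠ 0 := by exact_mod_cast x.den_nz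
    have hx' : x = x.num.sign * x.num.natAbs / x.den := by
      rw [← h, Rat.num_div_den]
    refine inv_eq_of_mul_eq_one_right ?_
    nth_rewrite 1 [hx']
    rw [Int.cast_mul, Int.cast_natCast]
    field_simp
    linear_combination hs
  · rw [Int.natAbs_mul, Int.natAbs_sign_of_ne_zero hn]
    simpa [add_comm, HtLE] using hx

theorem HtLE.div {x y : ℚ} {t u : ℕ} (hx : HtLE x t) (hy : HtLE y u) :
    HtLE (x / y) (t + u) := by
  rw [div_eq_mul_inv]; exact hx.mul hy.inv

theorem HtLE.pow {x : ℚ} {t : ℕ} (ht : 1 ≤ t) (hx : HtLE x t) {i e : ℕ} (hi : i + 1 ≤ e) :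
    HtLE (x ^ i) (e * t) := by
  refine HtLE.mono (t := (i + 1) * t) ?_ (Nat.mul_le_mul_right _ hi)
  clear hi
  induction i with
  | zero => simpa using HtLE.one ht
  | succ i ih => rw [pow_succ, add_mul, one_mul]; exact ih.mul hx

theorem HtLE.sum {ι : Type*} {I : Finset ι} {x : ι → ℚ} {t : ℕ} (h : ∀ i ∈ I, HtLE (x i) t) :
    HtLE (∑ i ∈ I, x i) (I.card * t) := by
  classical
  induction I using Finset.induction_on with
  | empty => simpa using HtLE.zero 0
  | insert a I ha ih =>
    rw [Finset.sum_insert ha, Finset.card_insert_of_notMem ha, add_mul, one_mul, add_comm]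
    exact (ih fun i hi => h i (Finset.mem_insert_of_mem hi)).add (h a (Finset.mem_insert_self _ _))

theorem HtLE.ratBits_le {x : ℚ} {t : ℕ} (h : HtLE x t) : ratBits x ≤ 2 * t + 3 := by
  have h1 : x.num.natAbs.size ≤ t + 1 :=
    Nat.size_le.mpr (lt_of_le_of_lt (le_trans (Nat.le_add_right _ _) h)
      (Nat.pow_lt_pow_right (by norm_num) (Nat.lt_succ_self t)))
  have h2 : x.den.size ≤ t + 1 :=
    Nat.size_le.mpr (lt_of_le_of_lt (le_trans (Nat.le_add_left _ _) h)
      (Nat.pow_lt_pow_right (by norm_num) (Nat.lt_succ_self t)))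
  unfold ratBits; omega

theorem HtLE.of_ratBits {x : ℚ} {t : ℕ} (h : ratBits x ≤ t) : HtLE x t := by
  refine HtLE.mono (t := ratBits x) ?_ h
  unfold HtLE ratBits
  have h1 := Nat.lt_size_self x.num.natAbs
  have h2 := Nat.lt_size_self x.den
  have h3 : 2 ^ x.num.natAbs.size ≤ 2 ^ (x.num.natAbs.size + x.den.size) :=
    Nat.pow_le_pow_right (by norm_num) (Nat.le_add_right _ _)
  have h4 : 2 ^ x.den.size ≤ 2 ^ (x.num.natAbs.size + x.den.size) :=
    Nat.pow_le_pow_right (by norm_num) (Nat.le_add_left _ _)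
  rw [pow_succ]; omega

theorem HtLE.abs_le {x : ℚ} {t : ℕ} (h : HtLE x t) : |x| ≤ 2 ^ t := by
  have h1 : |x| = x.num.natAbs / x.den := by
    conv_lhs => rw [← Rat.num_div_den x]
    rw [abs_div, Nat.abs_cast]
    simp
  have h2 : (1 : ℚ) ≤ x.den := by exact_mod_cast x.den_pos
  rw [h1, div_le_iff₀ (by linarith)]
  have h3 : (x.num.natAbs : ℚ) ≤ 2 ^ t := by
    exact_mod_cast le_trans (Nat.le_add_right _ _) h
  nlinarith [show (0 : ℚ) ≤ 2 ^ t by positivity]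

/-- The polynomial `p` has at most `s` terms, with coefficients of height at most `2 ^ t`. -/
def PolyHtLE {n : ℕ} (p : MvPolynomial (Fin n) ℚ) (s t : ℕ) : Prop :=
  p.support.card ≤ s ∧ ∀ e, HtLE (p.coeff e) t

variable {n : ℕ} {p q : MvPolynomial (Fin n) ℚ} {s s' t t' D D' T T' : ℕ}

theorem PolyHtLE.mono (h : PolyHtLE p s t) (hs : s ≤ s') (ht : t ≤ t') : PolyHtLE p s' t' :=
  ⟨h.1.trans hs, fun e => (h.2 e).mono ht⟩

theorem PolyHtLE.zero : PolyHtLE (0 : MvPolynomial (Fin n) ℚ) s t :=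
  ⟨by simp, fun e => by simpa using HtLE.zero t⟩

theorem PolyHtLE.monomial (e : Fin n →₀ ℕ) {c : ℚ} (h : HtLE c t) :
    PolyHtLE (monomial e c) 1 t := by
  classical
  refine ⟨le_trans (Finset.card_le_card support_monomial_subset) (by simp), fun e' => ?_⟩
  rw [coeff_monomial]
  split_ifs
  · exact h
  · exact HtLE.zero t

theorem PolyHtLE.neg (h : PolyHtLE p s t) : PolyHtLE (-p) s t :=
  ⟨by simpa using h.1, fun e => by simpa using (h.2 e).neg⟩

theorem PolyHtLE.add (hp : PolyHtLE p s t) (hq : PolyHtLE q s' t') :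
    PolyHtLE (p + q) (s + s') (t + t') := by
  classical
  refine ⟨le_trans (Finset.card_le_card support_add)
    (le_trans (Finset.card_union_le _ _) (add_le_add hp.1 hq.1)), fun e => ?_⟩
  rw [coeff_add]; exact (hp.2 e).add (hq.2 e)

theorem PolyHtLE.sub (hp : PolyHtLE p s t) (hq : PolyHtLE q s' t') :
    PolyHtLE (p - q) (s + s') (t + t') := by
  rw [sub_eq_add_neg]; exact hp.add hq.neg

theorem PolyHtLE.sum {ι : Type*} {I : Finset ι} {F : ι → MvPolynomial (Fin n) ℚ}
    (h : ∀ i ∈ I, PolyHtLE (F i) s t) : PolyHtLE (∑ i ∈ I, F i) (I.card * s) (I.card * t) := by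
  classical
  induction I using Finset.induction_on with
  | empty => simpa using PolyHtLE.zero
  | insert a I ha ih =>
    rw [Finset.sum_insert ha, Finset.card_insert_of_notMem ha, add_mul, one_mul, add_comm,
      add_mul, one_mul]
    exact (ih fun i hi => h i (Finset.mem_insert_of_mem hi)).add (h a (Finset.mem_insert_self _ _))

theorem PolyHtLE.monomial_mul (e : Fin n →₀ ℕ) {c : ℚ} (hc : HtLE c t') (h : PolyHtLE p s t) :
    PolyHtLE (MvPolynomial.monomial e c * p) s (t' + t) := by
  classical
  constructor
  · refine le_trans (Finset.card_le_card (support_mul _ _)) (le_trans Finset.card_add_le ?_)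
    refine le_trans (Nat.mul_le_mul (PolyHtLE.monomial e hc).1 h.1) (by simp)
  · intro e'
    rw [coeff_monomial_mul']
    split_ifs
    · exact hc.mul (h.2 _)
    · exact HtLE.zero _

theorem PolyHtLE.C_mul {c : ℚ} (hc : HtLE c t') (h : PolyHtLE p s t) :
    PolyHtLE (C c * p) s (t' + t) :=
  PolyHtLE.monomial_mul 0 hc h

theorem PolyHtLE.mul (hp : PolyHtLE p s t) (hq : PolyHtLE q s' t') :
    PolyHtLE (p * q) (s * s') (s * (t + t')) := by
  have e : p * q = ∑ e ∈ p.support, MvPolynomial.monomial e (p.coeff e) * q := by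
    rw [← Finset.sum_mul, ← p.as_sum]
  rw [e]
  exact (PolyHtLE.sum fun e _ => PolyHtLE.monomial_mul e (hp.2 e) hq).mono
    (Nat.mul_le_mul_right _ hp.1) (Nat.mul_le_mul_right _ hp.1)

theorem PolyHtLE.coeffBits_le (hp : PolyHtLE p s t) : coeffBits p ≤ s * (2 * t + 3) :=
  le_trans (Finset.sum_le_card_nsmul _ _ _ fun e _ => (hp.2 e).ratBits_le)
    (Nat.mul_le_mul_right _ hp.1)

/-- The polynomial `P` is a sum of `T` weighted squares `c p ^ 2` of degree at most `D`, with
`c` and `p` of bounded height. -/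
def IsWSOS (T D s t : ℕ) (P : MvPolynomial (Fin n) ℚ) : Prop :=
  ∃ (c : Fin T → ℚ) (p : Fin T → MvPolynomial (Fin n) ℚ),
    (∀ i, 0 ≤ c i ∧ HtLE (c i) t ∧ PolyHtLE (p i) s t ∧ (C (c i) * p i ^ 2).totalDegree ≤ D) ∧
    P = ∑ i, C (c i) * p i ^ 2

variable {P Q : MvPolynomial (Fin n) ℚ}

theorem IsWSOS.mono (h : IsWSOS T D s t P) (hD : D ≤ D') (hs : s ≤ s') (ht : t ≤ t') :
    IsWSOS T D' s' t' P := by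
  obtain ⟨c, p, h1, h2⟩ := h
  exact ⟨c, p, fun i => ⟨(h1 i).1, (h1 i).2.1.mono ht, (h1 i).2.2.1.mono hs ht,
    (h1 i).2.2.2.trans hD⟩, h2⟩

theorem IsWSOS.zero : IsWSOS T D s t (0 : MvPolynomial (Fin n) ℚ) :=
  ⟨fun _ => 0, fun _ => 0, fun _ => ⟨le_rfl, HtLE.zero t, PolyHtLE.zero, by simp⟩, by simp⟩

theorem IsWSOS.add (hP : IsWSOS T D s t P) (hQ : IsWSOS T' D s t Q) :
    IsWSOS (T + T') D s t (P + Q) := by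
  obtain ⟨c, p, h1, rfl⟩ := hP
  obtain ⟨c', p', h1', rfl⟩ := hQ
  refine ⟨Fin.append c c', Fin.append p p', fun i => ?_, ?_⟩
  · refine Fin.addCases (fun i => ?_) (fun i => ?_) i
    · simpa using h1 i
    · simpa using h1' i
  · simp [Fin.sum_univ_add]

theorem IsWSOS.mono_card (h : IsWSOS T D s t P) (hT : T ≤ T') : IsWSOS T' D s t P := by
  have := h.add (IsWSOS.zero (T := T' - T))
  rwa [add_zero, Nat.add_sub_cancel' hT] at this

theorem IsWSOS.single {c : ℚ} (h0 : 0 ≤ c) (hc : HtLE c t) (hp : PolyHtLE p s t)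
    (hD : c ≠ 0 → 2 * p.totalDegree ≤ D) : IsWSOS 1 D s t (C c * p ^ 2) := by
  refine ⟨fun _ => c, fun _ => p, fun _ => ⟨h0, hc, hp, ?_⟩, by simp⟩
  by_cases hc0 : c = 0
  · simp [hc0]
  · refine le_trans (totalDegree_mul _ _) ?_
    rw [totalDegree_C, zero_add]
    exact le_trans (totalDegree_pow _ _) (hD hc0)

theorem IsWSOS.sum {ι : Type*} {I : Finset ι} {F : ι → MvPolynomial (Fin n) ℚ}
    (h : ∀ i ∈ I, IsWSOS T D s t (F i)) : IsWSOS (I.card * T) D s t (∑ i ∈ I, F i) := by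
  classical
  induction I using Finset.induction_on with
  | empty => simpa using IsWSOS.zero
  | insert a I ha ih =>
    rw [Finset.sum_insert ha, Finset.card_insert_of_notMem ha, add_mul, one_mul, add_comm (F a)]
    exact (ih fun i hi => h i (Finset.mem_insert_of_mem hi)).add (h a (Finset.mem_insert_self _ _))

theorem IsWSOS.C_mul {c : ℚ} (h0 : 0 ≤ c) (hc : HtLE c t') (h : IsWSOS T D s t P) :
    IsWSOS T D s (t' + t) (C c * P) := by
  obtain ⟨c', p, h1, rfl⟩ := h
  refine ⟨fun i => c * c' i, p, fun i => ⟨mul_nonneg h0 (h1 i).1, hc.mul (h1 i).2.1,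
    (h1 i).2.2.1.mono le_rfl (Nat.le_add_left _ _), ?_⟩, ?_⟩
  · rw [C.map_mul, mul_assoc]
    refine le_trans (totalDegree_mul _ _) ?_
    rw [totalDegree_C, zero_add]
    exact (h1 i).2.2.2
  · rw [Finset.mul_sum]
    exact Finset.sum_congr rfl fun i _ => by rw [C.map_mul, mul_assoc]

theorem sum_weighted_sq_eq (b : ℕ → ℚ) (K y : ℚ) (m : ℕ) :
    ∑ j ∈ Finset.range (m + 1),
      ((1 / 8 + K * b (2 * j + 1) / 2) * (y ^ j + y ^ (j + 1)) ^ 2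
        + (1 / 8 - K * b (2 * j + 1) / 2) * (y ^ j - y ^ (j + 1)) ^ 2
        + (j + 1) * (K - 1 - j) * (y ^ j - y ^ (j + 2)) ^ 2
        + (2 * (K * b (2 * j)) + 1 / 4) * (y ^ j) ^ 2
        + (if j = 0 then 1 / 4 else 5 / 4) * (y ^ (j + 1)) ^ 2) =
      2 * K * ∑ i ∈ Finset.range (2 * (m + 1)), b i * y ^ i + (1 - y ^ (2 * (m + 1))) / 2
        + K - 1 - (m + 2) * (K - 2 - m) * y ^ (2 * (m + 1))
        + (m + 1) * (K - 1 - m) * y ^ (2 * (m + 2)) - y ^ 2 := by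
  induction m with
  | zero => simp [Finset.sum_range_succ]; ring
  | succ m ih =>
    rw [Finset.sum_range_succ, ih, show 2 * (m + 1 + 1) = 2 * (m + 1) + 1 + 1 by ring,
      Finset.sum_range_succ _ (2 * (m + 1) + 1), Finset.sum_range_succ _ (2 * (m + 1)),
      if_neg (Nat.succ_ne_zero m)]
    push_cast
    ring

theorem sum_weighted_sq_eq_domain (b : ℕ → ℚ) (y : ℚ) {k : ℕ} (hk : 1 ≤ k) :
    ∑ j ∈ Finset.range k,
      ((1 / 8 + k * b (2 * j + 1) / 2) * (y ^ j + y ^ (j + 1)) ^ 2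
        + (1 / 8 - k * b (2 * j + 1) / 2) * (y ^ j - y ^ (j + 1)) ^ 2
        + (j + 1) * (k - 1 - j) * (y ^ j - y ^ (j + 2)) ^ 2
        + (2 * (k * b (2 * j)) + 1 / 4) * (y ^ j) ^ 2
        + (if j = 0 then 1 / 4 else 5 / 4) * (y ^ (j + 1)) ^ 2)
      + 1 / 2 * (y ^ 0) ^ 2 + (k - 1 / 2) * (y ^ k) ^ 2 =
      k + 2 * k * (y ^ (2 * k) + ∑ i ∈ Finset.range (2 * k), b i * y ^ i) - y ^ 2 := by
  obtain ⟨m, rfl⟩ : ∃ m, k = m + 1 := ⟨k - 1, by omega⟩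
  rw [sum_weighted_sq_eq]
  push_cast
  ring

/-- The domain axiom as a polynomial with rational coefficients. -/
noncomputable def domainPoly {n N : ℕ} (ρ : Fin N → ℚ) (j : Fin n) : MvPolynomial (Fin n) ℚ :=
  ∏ i : Fin N, (X j - C (ρ i))

theorem toReal_domainPoly {n N : ℕ} (ρ : Fin N → ℚ) (j : Fin n) :
    toReal (domainPoly ρ j) = domainAxiom ρ j := by
  simp [toReal, domainPoly, domainAxiom, map_prod]

theorem totalDegree_domainPoly_le {n N : ℕ} (ρ : Fin N → ℚ) (j : Fin n) :
    (domainPoly ρ j).totalDegree ≤ N := by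
  refine le_trans (totalDegree_finsetProd _ _) (le_trans (Finset.sum_le_card_nsmul _ _ 1 ?_) ?_)
  · intro i _
    refine le_trans (totalDegree_sub _ _) ?_
    simp
  · simp

theorem eval_domainPoly {n N : ℕ} (ρ : Fin N → ℚ) (j : Fin n) (x : Fin n → ℚ) :
    eval x (domainPoly ρ j) =
      x j ^ N + ∑ i ∈ Finset.range N, domainCoeff ρ i * x j ^ i := by
  set P : Polynomial ℚ := ∏ l : Fin N, (Polynomial.X - Polynomial.C (ρ l)) with hP
  have hm : P.Monic := Polynomial.monic_prod_of_monic _ _ fun l _ => Polynomial.monic_X_sub_C _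
  have hd : P.natDegree = N := by
    rw [hP, Polynomial.natDegree_finsetProd_X_sub_C_eq_card]; simp
  have h1 : eval x (domainPoly ρ j) = P.eval (x j) := by
    simp [domainPoly, hP, Polynomial.eval_prod, map_prod]
  have h2 : P.coeff N = 1 := by rw [← hd]; exact hm
  rw [h1, Polynomial.eval_eq_sum_range, hd, Finset.sum_range_succ, h2, one_mul, add_comm]
  rfl

theorem ratBits_domainCoeff_le {N : ℕ} (ρ : Fin N → ℚ) {i : ℕ} (hi : i < N) :
    ratBits (domainCoeff ρ i) ≤ domainBits ρ :=
  le_trans (Finset.le_sup (f := fun i => ratBits (domainCoeff ρ i)) (Finset.mem_range.mpr hi))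
    (le_max_left _ _)

theorem PolyHtLE.scaled_X_pow {n : ℕ} (j : Fin n) {a : ℚ} {t i e : ℕ} (ht : 1 ≤ t)
    (ha : HtLE a t) (hi : i + 1 ≤ e) : PolyHtLE ((C a * X j : MvPolynomial (Fin n) ℚ) ^ i) 1 (e * t) := by
  rw [mul_pow, ← C.map_pow, C_mul_X_pow_eq_monomial]
  exact PolyHtLE.monomial _ (ha.pow ht hi)

theorem totalDegree_scaled_X_pow_le {n : ℕ} (j : Fin n) (a : ℚ) (i : ℕ) :
    ((C a * X j : MvPolynomial (Fin n) ℚ) ^ i).totalDegree ≤ i := by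
  rw [mul_pow, ← C.map_pow, C_mul_X_pow_eq_monomial]
  exact le_trans (totalDegree_monomial_le _ _) (by simp)

/-- A positive integer that dominates the coefficients of the domain polynomial. -/
noncomputable def domainRadius {k : ℕ} (ρ : Fin (2 * k) → ℚ) : ℕ := 8 * k * 2 ^ domainBits ρ

theorem domainRadius_pos {k : ℕ} (hk : 1 ≤ k) (ρ : Fin (2 * k) → ℚ) : 0 < domainRadius ρ := by
  unfold domainRadius; positivity

theorem htLE_domainRadius {k z : ℕ} (ρ : Fin (2 * k) → ℚ) (hz : k + domainBits ρ + 1 ≤ z) :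
    domainRadius ρ + 1 ≤ 2 ^ (4 * z) := by
  have h1 : k + 1 ≤ 2 ^ k := Nat.lt_two_pow_self
  have h2 : 1 ≤ 2 ^ domainBits ρ := Nat.one_le_two_pow
  calc domainRadius ρ + 1 ≤ 8 * (k + 1) * 2 ^ domainBits ρ := by unfold domainRadius; nlinarith
    _ ≤ 8 * 2 ^ k * 2 ^ domainBits ρ := by gcongr
    _ = 2 ^ (3 + k + domainBits ρ) := by rw [pow_add, pow_add]; norm_num
    _ ≤ 2 ^ (4 * z) := Nat.pow_le_pow_right (by norm_num) (by omega)

/-- The coefficients of the domain polynomial in the variable scaled by `domainRadius`. -/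
noncomputable def scaledCoeff {k : ℕ} (ρ : Fin (2 * k) → ℚ) (i : ℕ) : ℚ :=
  domainCoeff ρ i * (domainRadius ρ : ℚ) ^ i / (domainRadius ρ : ℚ) ^ (2 * k)

theorem abs_scaledCoeff_le {k : ℕ} (hk : 1 ≤ k) (ρ : Fin (2 * k) → ℚ) {i : ℕ} (hi : i < 2 * k) :
    |k * scaledCoeff ρ i| ≤ 1 / 8 := by
  have hR : (1 : ℚ) ≤ domainRadius ρ := by exact_mod_cast domainRadius_pos hk ρ
  have h1 : |domainCoeff ρ i| ≤ 2 ^ domainBits ρ :=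
    (HtLE.of_ratBits (ratBits_domainCoeff_le ρ hi)).abs_le
  have h2 : (domainRadius ρ : ℚ) = 8 * k * 2 ^ domainBits ρ := by
    unfold domainRadius; push_cast; ring
  have h3 : (domainRadius ρ : ℚ) ^ (i + 1) ≤ (domainRadius ρ : ℚ) ^ (2 * k) :=
    pow_le_pow_right₀ hR hi
  have h4 : (0 : ℚ) < (domainRadius ρ : ℚ) ^ (2 * k) := by positivity
  have h5 : (0 : ℚ) ≤ (domainRadius ρ : ℚ) ^ i := by positivity
  unfold scaledCoeff
  rw [abs_mul, abs_div, abs_mul, abs_of_nonneg h4.le, abs_of_nonneg h5, Nat.abs_cast, ← mul_div_assoc,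
    div_le_iff₀ h4]
  have h6 : |domainCoeff ρ i| * (domainRadius ρ : ℚ) ^ i * (8 * k) ≤
      (domainRadius ρ : ℚ) ^ (i + 1) := by
    rw [pow_succ]
    nth_rewrite 3 [h2]
    have : |domainCoeff ρ i| * ((domainRadius ρ : ℚ) ^ i * (8 * k)) ≤
      2 ^ domainBits ρ * ((domainRadius ρ : ℚ) ^ i * (8 * k)) := by gcongr
    linarith
  linarith

theorem htLE_scaledCoeff {k z : ℕ} (ρ : Fin (2 * k) → ℚ) (hz : k + domainBits ρ + 1 ≤ z)
    {i : ℕ} (hi : i < 2 * k) : HtLE (scaledCoeff ρ i) (21 * z ^ 2) := by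
  have hR : HtLE (domainRadius ρ : ℚ) (4 * z) := HtLE.natCast (htLE_domainRadius ρ hz)
  have h1 : HtLE (domainCoeff ρ i) z :=
    HtLE.of_ratBits ((ratBits_domainCoeff_le ρ hi).trans (by omega))
  refine ((h1.mul (hR.pow (e := 2 * z) (by omega) (by omega))).div
    (hR.pow (e := 2 * z) (by omega) (by omega))).mono ?_
  nlinarith

theorem eval_domainPoly_scaled {n k : ℕ} (hk : 1 ≤ k) (ρ : Fin (2 * k) → ℚ) (j : Fin n)
    (x : Fin n → ℚ) :
    eval x (domainPoly ρ j) = (domainRadius ρ : ℚ) ^ (2 * k) *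
      ((x j / domainRadius ρ) ^ (2 * k) +
        ∑ i ∈ Finset.range (2 * k), scaledCoeff ρ i * (x j / domainRadius ρ) ^ i) := by
  have hR : (domainRadius ρ : ℚ) ≠ 0 := by exact_mod_cast (domainRadius_pos hk ρ).ne'
  rw [eval_domainPoly, mul_add, Finset.mul_sum, ← mul_pow, mul_div_cancel₀ _ hR]
  congr 1
  refine Finset.sum_congr rfl fun i _ => ?_
  unfold scaledCoeff
  rw [div_pow]
  field_simp

/-- Modulo the domain axiom, a multiple of `r ^ 2` minus `(x_j r) ^ 2` is a sum of squares. -/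
theorem isWSOS_X_mul {n k d z : ℕ} (hk : 1 ≤ k) (ρ : Fin (2 * k) → ℚ)
    (hz : k + domainBits ρ + 1 ≤ z) (j : Fin n) {r : MvPolynomial (Fin n) ℚ}
    (hr : PolyHtLE r z z) (hd : r.totalDegree + 1 ≤ d) :
    IsWSOS (5 * k + 2) (2 * (d + k - 1)) (2 * z) (60 * z ^ 2)
      (C ((k * domainRadius ρ ^ 2 : ℕ) : ℚ) * r ^ 2
        + C (2 * k * (domainRadius ρ : ℚ) ^ 2 / (domainRadius ρ : ℚ) ^ (2 * k)) * r ^ 2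
          * domainPoly ρ j - (X j * r) ^ 2) := by
  have hR0 : (domainRadius ρ : ℚ) ≠ 0 := by exact_mod_cast (domainRadius_pos hk ρ).ne'
  have hR : HtLE (domainRadius ρ : ℚ) (4 * z) := HtLE.natCast (htLE_domainRadius ρ hz)
  set Y : MvPolynomial (Fin n) ℚ := C (domainRadius ρ : ℚ)⁻¹ * X j with hY
  have hY1 : ∀ i ≤ k + 1, PolyHtLE (Y ^ i) 1 (12 * z ^ 2) := fun i hi =>
    (PolyHtLE.scaled_X_pow j (e := 3 * z) (by omega) hR.inv (by omega)).mono le_rfl (by nlinarith)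
  have hYd : ∀ i, (Y ^ i).totalDegree ≤ i := totalDegree_scaled_X_pow_le j _
  have hp1 : ∀ i ≤ k, PolyHtLE (Y ^ i * r) (2 * z) (42 * z ^ 2) := fun i hi =>
    ((hY1 i (by omega)).mul hr).mono (by omega) (by nlinarith)
  have hp2 : ∀ i ≤ k + 1, ∀ i' ≤ k + 1, PolyHtLE ((Y ^ i + Y ^ i') * r) (2 * z) (50 * z ^ 2) :=
    fun i hi i' hi' => (((hY1 i hi).add (hY1 i' hi')).mul hr).mono (by omega) (by nlinarith)
  have hp3 : ∀ i ≤ k + 1, ∀ i' ≤ k + 1, PolyHtLE ((Y ^ i - Y ^ i') * r) (2 * z) (50 * z ^ 2) :=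
    fun i hi i' hi' => (((hY1 i hi).sub (hY1 i' hi')).mul hr).mono (by omega) (by nlinarith)
  have hd1 : ∀ i ≤ k, 2 * (Y ^ i * r).totalDegree ≤ 2 * (d + k - 1) := fun i hi => by
    have := totalDegree_mul (Y ^ i) r
    have := hYd i
    omega
  have hd2 : ∀ i ≤ k, ∀ i' ≤ k, 2 * ((Y ^ i + Y ^ i') * r).totalDegree ≤ 2 * (d + k - 1) :=
    fun i hi i' hi' => by
    have := totalDegree_mul (Y ^ i + Y ^ i') r
    have := totalDegree_add (Y ^ i) (Y ^ i')
    have := max_le ((hYd i).trans hi) ((hYd i').trans hi')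
    omega
  have hd3 : ∀ i ≤ k, ∀ i' ≤ k, 2 * ((Y ^ i - Y ^ i') * r).totalDegree ≤ 2 * (d + k - 1) :=
    fun i hi i' hi' => by
    have := totalDegree_mul (Y ^ i - Y ^ i') r
    have := totalDegree_sub (Y ^ i) (Y ^ i')
    have := max_le ((hYd i).trans hi) ((hYd i').trans hi')
    omega
  have hk1 : (1 : ℚ) ≤ k := by exact_mod_cast hk
  have hnat : ∀ i ≤ z, HtLE (i : ℚ) z := fun i hi =>
    HtLE.natCast (le_trans (Nat.succ_le_succ hi) Nat.lt_two_pow_self)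
  have c2 : HtLE (2 : ℚ) 2 := HtLE.natCast (N := 2) (by norm_num)
  have c4 : HtLE (4 : ℚ) 3 := HtLE.natCast (N := 4) (by norm_num)
  have c5 : HtLE (5 : ℚ) 3 := HtLE.natCast (N := 5) (by norm_num)
  have c8 : HtLE (8 : ℚ) 4 := HtLE.natCast (N := 8) (by norm_num)
  have c1 : HtLE (1 : ℚ) 1 := HtLE.one le_rfl
  have hkb : ∀ i < 2 * k, HtLE (k * scaledCoeff ρ i) (z + 21 * z ^ 2) := fun i hi =>
    (hnat k (by omega)).mul (htLE_scaledCoeff ρ hz hi)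
  have hkz : k + 1 ≤ z := by omega
  have hz2 : 2 * z ≤ z ^ 2 := by nlinarith
  set b := scaledCoeff ρ with hb
  have key : (C ((k * domainRadius ρ ^ 2 : ℕ) : ℚ) * r ^ 2
        + C (2 * k * (domainRadius ρ : ℚ) ^ 2 / (domainRadius ρ : ℚ) ^ (2 * k)) * r ^ 2
          * domainPoly ρ j - (X j * r) ^ 2 : MvPolynomial (Fin n) ℚ) = C ((domainRadius ρ : ℚ) ^ 2) *
      (∑ i ∈ Finset.range k,
      (C (1 / 8 + k * b (2 * i + 1) / 2) * ((Y ^ i + Y ^ (i + 1)) * r) ^ 2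
        + C (1 / 8 - k * b (2 * i + 1) / 2) * ((Y ^ i - Y ^ (i + 1)) * r) ^ 2
        + C ((i + 1) * (k - 1 - i) : ℚ) * ((Y ^ i - Y ^ (i + 2)) * r) ^ 2
        + C (2 * (k * b (2 * i)) + 1 / 4) * (Y ^ i * r) ^ 2
        + C (if i = 0 then 1 / 4 else 5 / 4 : ℚ) * (Y ^ (i + 1) * r) ^ 2)
      + C (1 / 2 : ℚ) * (Y ^ 0 * r) ^ 2 + C (k - 1 / 2 : ℚ) * (Y ^ k * r) ^ 2) := by
    refine MvPolynomial.funext fun x => ?_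
    have h := sum_weighted_sq_eq_domain b (x j / domainRadius ρ) hk
    have hx : (eval x) Y = x j / domainRadius ρ := by
      simp [hY, div_eq_inv_mul]
    simp only [map_sub, map_add, map_mul, map_pow, map_sum, eval_C, eval_X, hx,
      eval_domainPoly_scaled hk ρ]
    rw [← hb]
    trans (domainRadius ρ : ℚ) ^ 2 * ((k + 2 * k * ((x j / domainRadius ρ) ^ (2 * k) +
      ∑ i ∈ Finset.range (2 * k), b i * (x j / domainRadius ρ) ^ i)
        - (x j / domainRadius ρ) ^ 2) * eval x r ^ 2)
    · push_cast
      field_simp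
    · rw [← h, add_mul, add_mul, Finset.sum_mul]
      congr 1
      refine congrArg₂ _ (congrArg₂ _ (Finset.sum_congr rfl fun i _ => ?_) ?_) ?_ <;> ring
  rw [key]
  have hodd : ∀ i < k, |k * b (2 * i + 1)| ≤ 1 / 8 := fun i hi =>
    abs_scaledCoeff_le hk ρ (by omega)
  have heven : ∀ i < k, |k * b (2 * i)| ≤ 1 / 8 := fun i hi =>
    abs_scaledCoeff_le hk ρ (by omega)
  refine (IsWSOS.C_mul (t' := 8 * z ^ 2) (t := 52 * z ^ 2) (by positivity)
    ((hR.pow (e := 3) (by omega) le_rfl).mono (by nlinarith)) ?_).mono le_rfl le_rfl (by omega)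
  refine ((IsWSOS.add (IsWSOS.add (IsWSOS.sum (T := 1 + 1 + 1 + 1 + 1) fun i hi => ?_)
    (IsWSOS.single ?_ ?_ ?_ ?_)) (IsWSOS.single ?_ ?_ ?_ ?_))).mono_card (by simp; omega)
  · have hi : i < k := Finset.mem_range.mp hi
    have hiq : (i : ℚ) + 1 ≤ k := by exact_mod_cast hi
    have h1 := abs_le.mp (hodd i hi)
    have h2 := abs_le.mp (heven i hi)
    have t1 := ((hkb (2 * i + 1) (by omega)).div c2)
    refine IsWSOS.add (IsWSOS.add (IsWSOS.add (IsWSOS.add ?_ ?_) ?_) ?_) ?_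
    · exact IsWSOS.single (by linarith) (((c1.div c8).add t1).mono (by omega))
        ((hp2 _ (by omega) _ (by omega)).mono le_rfl (by omega))
        fun _ => hd2 _ (by omega) _ (by omega)
    · exact IsWSOS.single (by linarith) (((c1.div c8).sub t1).mono (by omega))
        ((hp3 _ (by omega) _ (by omega)).mono le_rfl (by omega))
        fun _ => hd3 _ (by omega) _ (by omega)
    · refine IsWSOS.single (mul_nonneg (by positivity) (by linarith))
        ((((hnat i (by omega)).add c1).mul
          (((hnat k (by omega)).sub c1).sub (hnat i (by omega)))).mono (by omega))
        ((hp3 _ (by omega) _ (by omega)).mono le_rfl (by omega)) fun h => ?_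
      have : i + 1 ≠ k := by
        rintro rfl
        exact h (by push_cast; ring)
      exact hd3 _ (by omega) _ (by omega)
    · exact IsWSOS.single (by linarith)
        (((c2.mul (hkb (2 * i) (by omega))).add (c1.div c4)).mono (by omega))
        ((hp1 _ (by omega)).mono le_rfl (by omega)) fun _ => hd1 _ (by omega)
    · refine IsWSOS.single (by split_ifs <;> norm_num) ?_
        ((hp1 _ (by omega)).mono le_rfl (by omega)) fun _ => hd1 _ (by omega)
      split_ifs
      · exact (c1.div c4).mono (by omega)
      · exact (c5.div c4).mono (by omega)
  · norm_num
  · exact (c1.div c2).mono (by omega)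
  · exact (hp1 _ (by omega)).mono le_rfl (by omega)
  · exact fun _ => hd1 _ (by omega)
  · linarith
  · exact ((hnat k (by omega)).sub (c1.div c2)).mono (by omega)
  · exact (hp1 _ le_rfl).mono le_rfl (by omega)
  · exact fun _ => hd1 _ le_rfl

theorem toReal_injective : Function.Injective (toReal (n := n)) :=
  map_injective _ (algebraMap ℚ ℝ).injective

theorem coeff_toReal (p : MvPolynomial (Fin n) ℚ) (e : Fin n →₀ ℕ) :
    (toReal p).coeff e = ((p.coeff e : ℚ) : ℝ) := by
  simp [toReal, coeff_map]

theorem exists_rat_smul {r s : MvPolynomial (Fin n) ℚ} {a : ℝ} {t : ℕ}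
    (hr : ∀ e, HtLE (r.coeff e) t) (hs : ∀ e, HtLE (s.coeff e) t)
    (h : ∀ e, ((r.coeff e : ℚ) : ℝ) = a * (s.coeff e : ℚ)) :
    ∃ a' : ℚ, HtLE a' (8 * t) ∧ r = C a' * s := by
  by_cases hs0 : ∀ e, s.coeff e = 0
  · refine ⟨0, HtLE.zero _, ?_⟩
    ext e
    have := h e
    rw [hs0 e] at this
    simpa using this
  · push Not at hs0
    obtain ⟨e, he⟩ := hs0
    have ha : a = ((r.coeff e / s.coeff e : ℚ) : ℝ) := by
      have he' : ((s.coeff e : ℚ) : ℝ) ≠ 0 := by exact_mod_cast he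
      push_cast
      rw [h e]
      field_simp
    refine ⟨r.coeff e / s.coeff e, ((hr e).div (hs e)).mono (by omega), ?_⟩
    ext e'
    have := h e'
    rw [ha] at this
    rw [coeff_C_mul]
    exact_mod_cast this

/-- A rational polynomial that is a real linear combination of two rational ones is a rational
linear combination of them, with coefficients of controlled height. -/
theorem exists_rat_combination {r r₁ r₂ : MvPolynomial (Fin n) ℚ} {a b : ℝ} {t : ℕ}
    (hr : ∀ e, HtLE (r.coeff e) t) (hr₁ : ∀ e, HtLE (r₁.coeff e) t)
    (hr₂ : ∀ e, HtLE (r₂.coeff e) t)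
    (h : toReal r = C a * toReal r₁ + C b * toReal r₂) :
    ∃ a' b' : ℚ, HtLE a' (8 * t) ∧ HtLE b' (8 * t) ∧ r = C a' * r₁ + C b' * r₂ := by
  have hc : ∀ e, ((r.coeff e : ℚ) : ℝ) = a * (r₁.coeff e : ℚ) + b * (r₂.coeff e : ℚ) := fun e => by
    have := congrArg (coeff e) h
    simpa only [coeff_add, coeff_C_mul, coeff_toReal] using this
  by_cases hdet : ∃ e e', r₁.coeff e * r₂.coeff e' - r₁.coeff e' * r₂.coeff e ≠ 0
  · obtain ⟨e, e', hd⟩ := hdet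
    have hd' : ((r₁.coeff e * r₂.coeff e' - r₁.coeff e' * r₂.coeff e : ℚ) : ℝ) ≠ 0 := by
      exact_mod_cast hd
    have hD := ((hr₁ e).mul (hr₂ e')).sub ((hr₁ e').mul (hr₂ e))
    set a' : ℚ := (r.coeff e * r₂.coeff e' - r.coeff e' * r₂.coeff e) /
      (r₁.coeff e * r₂.coeff e' - r₁.coeff e' * r₂.coeff e) with ha'
    set b' : ℚ := (r₁.coeff e * r.coeff e' - r₁.coeff e' * r.coeff e) /
      (r₁.coeff e * r₂.coeff e' - r₁.coeff e' * r₂.coeff e) with hb'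
    have ha : a = a' := by
      rw [ha', Rat.cast_div, eq_div_iff hd']
      push_cast
      rw [hc e, hc e']
      ring
    have hb : b = b' := by
      rw [hb', Rat.cast_div, eq_div_iff hd']
      push_cast
      rw [hc e, hc e']
      ring
    refine ⟨a', b',
      ((((hr e).mul (hr₂ e')).sub ((hr e').mul (hr₂ e))).div hD).mono (by omega),
      ((((hr₁ e).mul (hr e')).sub ((hr₁ e').mul (hr e))).div hD).mono (by omega), ?_⟩
    ext m
    have := hc m
    rw [ha, hb] at this
    rw [coeff_add, coeff_C_mul, coeff_C_mul]
    exact_mod_cast this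
  · push Not at hdet
    by_cases h1 : ∀ e, r₁.coeff e = 0
    · obtain ⟨b', hb', h'⟩ := exists_rat_smul (a := b) hr hr₂ fun e => by
        rw [hc e, h1 e]; simp
      exact ⟨0, b', HtLE.zero _, hb', by simpa using h'⟩
    · push Not at h1
      obtain ⟨e, he⟩ := h1
      have he' : ((r₁.coeff e : ℚ) : ℝ) ≠ 0 := by exact_mod_cast he
      obtain ⟨a', ha', h'⟩ := exists_rat_smul (a := a + b * (r₂.coeff e / r₁.coeff e : ℚ)) hr hr₁
        fun e' => by
          have hd : ((r₁.coeff e * r₂.coeff e' - r₁.coeff e' * r₂.coeff e : ℚ) : ℝ) = 0 := by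
            exact_mod_cast hdet e e'
          push_cast at hd ⊢
          rw [hc e']
          field_simp
          linear_combination b * hd
      exact ⟨a', 0, ha', HtLE.zero _, by simpa using h'⟩

theorem isWSOS_combination {r₁ r₂ : MvPolynomial (Fin n) ℚ} {a b : ℚ} {z d D : ℕ} (hz : 2 ≤ z)
    (ha : HtLE a (8 * z)) (hb : HtLE b (8 * z)) (hr₁ : PolyHtLE r₁ z z) (hr₂ : PolyHtLE r₂ z z)
    (hd₁ : r₁.totalDegree ≤ d) (hd₂ : r₂.totalDegree ≤ d) (hD : 2 * d ≤ D) :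
    IsWSOS 3 D (2 * z) (60 * z ^ 2)
      (C ((2 ^ (16 * z + 1) : ℕ) : ℚ) * r₁ ^ 2 + C ((2 ^ (16 * z + 1) : ℕ) : ℚ) * r₂ ^ 2
        - (C a * r₁ + C b * r₂) ^ 2) := by
  have hz2 : 2 * z ≤ z ^ 2 := by nlinarith
  have hc : HtLE ((2 ^ (16 * z + 1) : ℕ) : ℚ) (16 * z + 2) := HtLE.natCast (by
    have := Nat.one_le_two_pow (n := 16 * z + 1)
    rw [pow_succ _ (16 * z + 1)]; omega)
  have c2 : HtLE (2 : ℚ) 2 := HtLE.natCast (N := 2) (by norm_num)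
  have hsq : ∀ x : ℚ, HtLE x (8 * z) → 2 * x ^ 2 ≤ ((2 ^ (16 * z + 1) : ℕ) : ℚ) := fun x hx => by
    have h1 := pow_le_pow_left₀ (abs_nonneg x) hx.abs_le 2
    rw [sq_abs, ← pow_mul] at h1
    push_cast
    rw [pow_succ (2 : ℚ) (16 * z), show 16 * z = 8 * z * 2 by ring]
    linarith
  have hht : ∀ x : ℚ, HtLE x (8 * z) →
      HtLE (((2 ^ (16 * z + 1) : ℕ) : ℚ) - 2 * x ^ 2) (60 * z ^ 2) := fun x hx => by
    rw [pow_two]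
    exact (hc.sub (c2.mul (hx.mul hx))).mono (by omega)
  have e : (C ((2 ^ (16 * z + 1) : ℕ) : ℚ) * r₁ ^ 2 + C ((2 ^ (16 * z + 1) : ℕ) : ℚ) * r₂ ^ 2
        - (C a * r₁ + C b * r₂) ^ 2 : MvPolynomial (Fin n) ℚ) =
      C (((2 ^ (16 * z + 1) : ℕ) : ℚ) - 2 * a ^ 2) * r₁ ^ 2
        + C (((2 ^ (16 * z + 1) : ℕ) : ℚ) - 2 * b ^ 2) * r₂ ^ 2
        + C 1 * (C a * r₁ - C b * r₂) ^ 2 := by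
    simp only [map_sub, map_mul, map_pow, map_one]
    rw [show (C (2 : ℚ) : MvPolynomial (Fin n) ℚ) = 2 from map_ofNat C 2]
    ring
  rw [e]
  refine IsWSOS.add (T := 2) (T' := 1) (IsWSOS.add (T := 1) (T' := 1)
    (IsWSOS.single (by linarith [hsq a ha]) (hht a ha) (hr₁.mono (by omega) (by omega))
      fun _ => by omega)
    (IsWSOS.single (by linarith [hsq b hb]) (hht b hb) (hr₂.mono (by omega) (by omega))
      fun _ => by omega))
    (IsWSOS.single zero_le_one (HtLE.one (by omega))
      (((hr₁.C_mul ha).sub (hr₂.C_mul hb)).mono (by omega) (by omega)) fun _ => ?_)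
  have h1 := totalDegree_sub (C a * r₁) (C b * r₂)
  have h2 := totalDegree_mul (C a) r₁
  have h3 := totalDegree_mul (C b) r₂
  rw [totalDegree_C] at h2 h3
  have := max_le (h2.trans (by simpa using hd₁)) (h3.trans (by simpa using hd₂))
  omega

/-- Each line of a derivation is bounded, modulo the axioms, by a combination of the squares of
the earlier lines. -/
theorem exists_line_bound {m k L d z : ℕ} (hk : 1 ≤ k) {f : Fin m → MvPolynomial (Fin n) ℝ}
    {ρ : Fin (2 * k) → ℚ} {r : Fin L → MvPolynomial (Fin n) ℚ}
    (hpc : IsPCDerivation f ρ fun h => toReal (r h)) (hz : k + domainBits ρ + 1 ≤ z)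
    (hr : ∀ h, PolyHtLE (r h) z z) (hd : ∀ h, (r h).totalDegree ≤ d) (h : Fin L) :
    ∃ (v : Fin L → ℕ) (a : Fin m → ℚ) (q : Fin n → MvPolynomial (Fin n) ℚ),
      (∀ h', v h' ≤ 2 ^ (20 * z)) ∧ (∀ h', v h' ≠ 0 → h' < h) ∧
      (∀ i, a i ≠ 0 → a i = 1 ∧ toReal (r h) = f i) ∧
      (Finset.univ.filter fun i => a i ≠ 0).card ≤ 1 ∧
      (Finset.univ.filter fun j => q j ≠ 0).card ≤ 1 ∧
      (∀ j, PolyHtLE (q j) (z ^ 2) (30 * z ^ 2)) ∧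
      (∀ j, (q j * domainPoly ρ j).totalDegree ≤ 2 * (d + k - 1)) ∧
      IsWSOS (5 * k + 2) (2 * (d + k - 1)) (2 * z) (60 * z ^ 2)
        (∑ h', C (v h' : ℚ) * r h' ^ 2 + ∑ i, C (a i) * r h ^ 2 + ∑ j, q j * domainPoly ρ j
          - r h ^ 2) := by
  classical
  have hz1 : 2 ≤ z := by omega
  have hz2 : 2 * z ≤ z ^ 2 := by nlinarith
  rcases hpc h with ⟨i, hi⟩ | ⟨j, hj⟩ | ⟨h₁, h₂, hh₁, hh₂, a, b, hab⟩ | ⟨h₁, hh₁, j, hj⟩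
  · refine ⟨fun _ => 0, Pi.single i 1, fun _ => 0, by simp, by simp, ?_, ?_, by simp,
      fun _ => PolyHtLE.zero, by simp, ?_⟩
    · intro i' hi'
      have : i' = i := by
        by_contra hne
        exact hi' (by simp [hne])
      subst this
      exact ⟨by simp, hi⟩
    · refine Finset.card_le_one.mpr fun x hx y hy => ?_
      simp [Pi.single_apply] at hx hy
      rw [hx, hy]
    · have : (∑ i', C ((Pi.single i 1 : Fin m → ℚ) i') * r h ^ 2 : MvPolynomial (Fin n) ℚ)
          = r h ^ 2 := by
        rw [Finset.sum_eq_single i]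
        · simp
        · intro i' _ hne; simp [hne]
        · simp
      rw [this]
      simpa using IsWSOS.zero
  · have hj : r h = domainPoly ρ j := toReal_injective (by rw [toReal_domainPoly]; exact hj)
    refine ⟨fun _ => 0, fun _ => 0, Pi.single j (r h), by simp, by simp, by simp, by simp, ?_,
      ?_, ?_, ?_⟩
    · refine Finset.card_le_one.mpr fun x hx y hy => ?_
      simp [Pi.single_apply] at hx hy
      rw [hx.1, hy.1]
    · intro j'
      rcases eq_or_ne j' j with rfl | hne
      · simpa using (hr h).mono (by omega) (by omega)
      · simpa [hne] using PolyHtLE.zero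
    · intro j'
      rcases eq_or_ne j' j with rfl | hne
      · have h1 := totalDegree_mul (r h) (domainPoly ρ j')
        have h2 := hd h
        rw [← hj] at h1 ⊢
        simp only [Pi.single_eq_same]
        omega
      · simp [hne]
    · have : (∑ j', (Pi.single j (r h) : Fin n → MvPolynomial (Fin n) ℚ) j' * domainPoly ρ j')
          = r h ^ 2 := by
        rw [Finset.sum_eq_single j]
        · simp [← hj, pow_two]
        · intro i' _ hne; simp [hne]
        · simp
      rw [this]
      simpa using IsWSOS.zero
  · obtain ⟨a', b', ha, hb, hab⟩ := exists_rat_combination (hr h).2 (hr h₁).2 (hr h₂).2 hab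
    refine ⟨2 ^ (16 * z + 1) • (Pi.single h₁ 1 + Pi.single h₂ 1), fun _ => 0, fun _ => 0, ?_, ?_,
      by simp, by simp, by simp, fun _ => PolyHtLE.zero, by simp, ?_⟩
    · intro h'
      refine le_trans (?_ : _ ≤ 2 ^ (16 * z + 1) * 2) ?_
      · simp only [Pi.smul_apply, Pi.add_apply, smul_eq_mul]
        refine Nat.mul_le_mul_left _ ?_
        simp only [Pi.single_apply]
        split_ifs <;> omega
      · rw [← pow_succ]
        exact Nat.pow_le_pow_right (by norm_num) (by omega)
    · intro h' hh'
      by_contra hlt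
      have n1 : h' ≠ h₁ := by rintro rfl; exact hlt hh₁
      have n2 : h' ≠ h₂ := by rintro rfl; exact hlt hh₂
      exact hh' (by simp [n1, n2])
    · have : (∑ h', C (((2 ^ (16 * z + 1) • (Pi.single h₁ 1 + Pi.single h₂ 1) : Fin L → ℕ) h' : ℕ) : ℚ)
          * r h' ^ 2 : MvPolynomial (Fin n) ℚ) = C ((2 ^ (16 * z + 1) : ℕ) : ℚ) * r h₁ ^ 2
            + C ((2 ^ (16 * z + 1) : ℕ) : ℚ) * r h₂ ^ 2 := by
        simp only [Pi.smul_apply, Pi.add_apply, smul_eq_mul, Nat.cast_mul, Nat.cast_add, C.map_mul,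
          C.map_add, mul_add, add_mul, Finset.sum_add_distrib]
        simp [Pi.single_apply, apply_ite]
      rw [this]
      have := (isWSOS_combination hz1 ha hb (hr h₁) (hr h₂) (hd h₁) (hd h₂)
        (D := 2 * (d + k - 1)) (by omega)).mono_card (T' := 5 * k + 2) (by omega)
      rw [← hab] at this
      simpa using this
  · have hj : r h = X j * r h₁ := toReal_injective (by
      rw [show toReal (r h) = _ from hj]; simp [toReal])
    by_cases h0 : r h₁ = 0
    · refine ⟨fun _ => 0, fun _ => 0, fun _ => 0, by simp, by simp, by simp, by simp, by simp,
        fun _ => PolyHtLE.zero, by simp, ?_⟩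
      simpa [hj, h0] using IsWSOS.zero
    have hdeg : (r h₁).totalDegree + 1 ≤ d := by
      have := hd h
      rw [hj, totalDegree_mul_of_isDomain (X_ne_zero j) h0, totalDegree_X] at this
      omega
    have hR := htLE_domainRadius ρ hz
    have hRq : HtLE (domainRadius ρ : ℚ) (4 * z) := HtLE.natCast hR
    have hkz : k + 1 ≤ 2 ^ z := lt_of_lt_of_le (Nat.lt_two_pow_self (n := k))
      (Nat.pow_le_pow_right (by norm_num) (by omega))
    set γ : ℚ := 2 * k * (domainRadius ρ : ℚ) ^ 2 / (domainRadius ρ : ℚ) ^ (2 * k) with hγ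
    have hγt : HtLE γ (28 * z ^ 2) :=
      ((((HtLE.natCast (N := 2) (t := 2) (by norm_num)).mul (HtLE.natCast hkz)).mul
        (hRq.pow (e := 3) (by omega) le_rfl)).div
          (hRq.pow (e := 2 * z) (by omega) (by omega))).mono (by nlinarith)
    have hq : PolyHtLE (C γ * r h₁ ^ 2) (z ^ 2) (30 * z ^ 2) := by
      rw [pow_two (r h₁)]
      exact (((hr h₁).mul (hr h₁)).C_mul hγt).mono (by nlinarith) (by nlinarith)
    refine ⟨Pi.single h₁ (k * domainRadius ρ ^ 2), fun _ => 0, Pi.single j (C γ * r h₁ ^ 2),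
      ?_, ?_, by simp, by simp, ?_, ?_, ?_, ?_⟩
    · intro h'
      refine le_trans (?_ : _ ≤ 2 ^ z * (2 ^ (4 * z)) ^ 2) ?_
      · rcases eq_or_ne h' h₁ with rfl | hne
        · rw [Pi.single_eq_same]
          exact Nat.mul_le_mul (by omega) (Nat.pow_le_pow_left (by omega) 2)
        · simp [hne]
      · rw [← pow_mul, ← pow_add]
        exact Nat.pow_le_pow_right (by norm_num) (by omega)
    · intro h' hh'
      have : h' = h₁ := by
        by_contra hne
        exact hh' (by simp [hne])
      rwa [this]
    · refine Finset.card_le_one.mpr fun x hx y hy => ?_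
      simp only [Pi.single_apply, ne_eq, ite_eq_right_iff, Finset.mem_filter, Finset.mem_univ,
        true_and, Classical.not_imp] at hx hy
      rw [hx.1, hy.1]
    · intro j'
      rcases eq_or_ne j' j with rfl | hne
      · simpa using hq
      · simpa [hne] using PolyHtLE.zero
    · intro j'
      rcases eq_or_ne j' j with rfl | hne
      · rw [Pi.single_eq_same]
        have h1 := totalDegree_mul (C γ * r h₁ ^ 2) (domainPoly ρ j')
        have h2 := totalDegree_mul (C γ) (r h₁ ^ 2)
        have h3 := totalDegree_pow (r h₁) 2
        have h4 := totalDegree_domainPoly_le ρ j'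
        rw [totalDegree_C] at h2
        omega
      · simp [hne]
    · have e1 : (∑ h', C (((Pi.single h₁ (k * domainRadius ρ ^ 2) : Fin L → ℕ) h' : ℕ) : ℚ)
          * r h' ^ 2 : MvPolynomial (Fin n) ℚ) =
            C ((k * domainRadius ρ ^ 2 : ℕ) : ℚ) * r h₁ ^ 2 := by
        rw [Finset.sum_eq_single h₁]
        · rw [Pi.single_eq_same]
        · intro i' _ hne; simp [hne]
        · simp
      have e2 : (∑ j', (Pi.single j (C γ * r h₁ ^ 2) : Fin n → MvPolynomial (Fin n) ℚ) j'
          * domainPoly ρ j') = C γ * r h₁ ^ 2 * domainPoly ρ j := by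
        rw [Finset.sum_eq_single j]
        · rw [Pi.single_eq_same]
        · intro i' _ hne; simp [hne]
        · simp
      rw [e1, e2, hj]
      simpa using isWSOS_X_mul hk ρ hz j (hr h₁) hdeg

theorem sum_le_mul_of_support {ι : Type*} [Fintype ι] {F : ι → ℕ} {I : Finset ι} {N U : ℕ}
    (h0 : ∀ i, i ∉ I → F i = 0) (hU : ∀ i, F i ≤ U) (hN : I.card ≤ N) : ∑ i, F i ≤ N * U := by
  rw [← Finset.sum_subset (Finset.subset_univ I) fun i _ hi => h0 i hi]
  exact le_trans (Finset.sum_le_card_nsmul _ _ _ fun i _ => hU i) (Nat.mul_le_mul_right _ hN)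

theorem totalDegree_toReal_le {n : ℕ} (p : MvPolynomial (Fin n) ℚ) :
    (toReal p).totalDegree ≤ p.totalDegree :=
  Finset.sup_mono (support_map_subset _ _)

theorem polyHtLE_of_polySize {n S : ℕ} {p : MvPolynomial (Fin n) ℚ} (h : polySize p ≤ S) :
    PolyHtLE p S S := by
  unfold polySize at h
  constructor
  · refine le_trans ?_ h
    refine le_trans (le_trans (by simp) (Finset.card_nsmul_le_sum p.support _ 1 fun e _ => ?_))
      (Nat.le_succ _)
    unfold ratBits
    omega
  · intro e
    by_cases he : e ∈ p.support
    · have := Finset.single_le_sum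
        (f := fun s => ratBits (p.coeff s) + monoBits s) (fun _ _ => Nat.zero_le _) he
      exact HtLE.of_ratBits (by omega)
    · rw [notMem_support_iff.mp he]
      exact HtLE.zero _

theorem sum_Ioc_geom_le {L : ℕ} (M : ℕ) (h H : Fin L) :
    (∑ h' ∈ Finset.Ioc h H, (M + 1) ^ ((H : ℕ) - h') * M) + 1 ≤ (M + 1) ^ ((H : ℕ) - h) := by
  rw [← Finset.sum_mul, ← geom_sum_mul_add]
  refine Nat.succ_le_succ (Nat.mul_le_mul_right _ ?_)
  have hinj : Set.InjOn (fun h' : Fin L => (H : ℕ) - h') (Finset.Ioc h H : Set (Fin L)) := by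
    intro x hx y hy hxy
    simp only [Finset.coe_Ioc, Set.mem_Ioc, Fin.lt_def, Fin.le_def] at hx hy hxy
    apply Fin.ext
    omega
  rw [← Finset.sum_image (f := fun e => (M + 1) ^ e) hinj]
  refine Finset.sum_le_sum_of_subset fun e he => ?_
  obtain ⟨x, hx, rfl⟩ := Finset.mem_image.mp he
  simp only [Finset.mem_Ioc, Fin.lt_def, Fin.le_def] at hx
  rw [Finset.mem_range]
  omega

/-- The bound on the bit length of a proof that results from the bounds on its parts. -/
theorem proofBits_le {z A G Q U W : ℕ} (hz : 1 ≤ z) (hA : A ≤ z * (2 * (22 * z ^ 3) + 3))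
    (hG : G ≤ z * (z ^ 2 * (2 * (23 * z ^ 3) + 3)))
    (hQ : Q ≤ z * (z ^ 3 * (2 * (51 * z ^ 3) + 3)))
    (hU : U ≤ 8 * z ^ 2 * (2 * (81 * z ^ 2) + 3))
    (hW : W ≤ 8 * z ^ 2 * (2 * z * (2 * (81 * z ^ 2) + 3))) :
    A + G + Q + U + W ≤ 5000 * z ^ 7 := by
  have h : ∀ i ≤ 7, z ^ i ≤ z ^ 7 := fun i hi => Nat.pow_le_pow_right hz hi
  have h1 := h 1 (by norm_num)
  have h2 := h 2 (by norm_num)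
  have h3 := h 3 (by norm_num)
  have h4 := h 4 (by norm_num)
  have h5 := h 5 (by norm_num)
  have h6 := h 6 (by norm_num)
  ring_nf at *
  linarith

theorem exists_sos_proof {n m k L d z : ℕ} (hk : 1 ≤ k) {f : Fin m → MvPolynomial (Fin n) ℝ}
    {ρ : Fin (2 * k) → ℚ} {r : Fin L → MvPolynomial (Fin n) ℚ}
    (hpc : IsPCDerivation f ρ fun h => toReal (r h)) (hz : k + domainBits ρ + 1 ≤ z)
    (hr : ∀ h, PolyHtLE (r h) z z) (hd : ∀ h, (r h).totalDegree ≤ d) (hL : L ≤ z) (H : Fin L) :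
    ∃ (m₁ : ℕ) (a : Fin m → ℚ) (g : Fin m → MvPolynomial (Fin n) ℚ)
      (q : Fin n → MvPolynomial (Fin n) ℚ) (c : Fin m₁ → ℚ)
      (p : Fin m₁ → MvPolynomial (Fin n) ℚ),
      m₁ ≤ 8 * (k * (H + 1)) ∧ (∀ i, 0 ≤ a i) ∧ (∀ j, 0 ≤ c j) ∧
      (∀ i, toReal (g i) = -C (a i : ℝ) * f i) ∧
      ∑ i, (-C (a i : ℝ) * f i) * f i + ∑ j, toReal (q j) * domainAxiom ρ j
          + ∑ j, C (c j : ℝ) * toReal (p j) ^ 2 = -toReal (r H) ^ 2 ∧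
      (∀ i, a i ≠ 0 → (f i).totalDegree ≤ d) ∧
      (∀ j, (q j * domainPoly ρ j).totalDegree ≤ 2 * (d + k - 1)) ∧
      (∀ j, (C (c j) * p j ^ 2).totalDegree ≤ 2 * (d + k - 1)) ∧
      proofBits a g q c p ≤ 5000 * z ^ 7 := by
  classical
  choose v a q hv hvlt ha hac hqc hq hqd hws using exists_line_bound hk hpc hz hr hd
  have hz2 : 2 * z ≤ z ^ 2 := by nlinarith
  set M : ℕ := 2 ^ (20 * z) with hM
  set W : Fin L → ℕ := fun h => (M + 1) ^ ((H : ℕ) - h) with hW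
  set I : Finset (Fin L) := Finset.Iic H with hI
  have hIc : I.card = H + 1 := by simp [hI]
  have hIz : I.card ≤ z := by rw [hIc]; exact le_trans H.isLt hL
  set V : Fin L → ℕ := fun h => ∑ h' ∈ I, W h' * v h' h with hV
  have hVW : ∀ h, V h + 1 ≤ W h := fun h => by
    refine le_trans (Nat.succ_le_succ ?_) (sum_Ioc_geom_le M h H)
    rw [hV]
    simp only
    rw [← Finset.sum_subset (s₁ := Finset.Ioc h H)]
    · exact Finset.sum_le_sum fun h' _ => Nat.mul_le_mul_left _ (hv h' h)
    · intro x hx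
      exact Finset.mem_Iic.mpr (Finset.mem_Ioc.mp hx).2
    · intro x hx hx'
      have : v x h = 0 := by
        by_contra hne
        exact hx' (Finset.mem_Ioc.mpr ⟨hvlt x h hne, Finset.mem_Iic.mp hx⟩)
      rw [this, mul_zero]
  have hV0 : ∀ h, h ∉ I → V h = 0 := fun h hh => by
    refine Finset.sum_eq_zero fun h' hh' => ?_
    have : v h' h = 0 := by
      by_contra hne
      exact hh (Finset.mem_Iic.mpr ((hvlt h' h hne).le.trans (Finset.mem_Iic.mp hh')))
    rw [this, mul_zero]
  have hM2 : HtLE ((M + 1 : ℕ) : ℚ) (20 * z + 2) := HtLE.natCast (by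
    have : 1 ≤ M := Nat.one_le_two_pow
    rw [pow_add, ← hM]
    omega)
  have hWt : ∀ h, HtLE (W h : ℚ) (21 * z ^ 2) := fun h => by
    rw [hW]
    simp only
    rw [Nat.cast_pow]
    have := H.isLt
    exact (hM2.pow (e := z) (by omega) (by omega)).mono (by nlinarith)
  set e : Fin L → ℕ := fun h => W h - (V h + if h = H then 1 else 0) with he
  have heq : ∀ h, (e h : ℚ) = W h - (V h + if h = H then 1 else 0) := fun h => by
    have := hVW h
    rw [he]
    simp only
    rw [Nat.cast_sub (by split_ifs <;> omega)]
    push_cast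
    rfl
  have het : ∀ h, HtLE (e h : ℚ) (21 * z ^ 2) := fun h => by
    have h1 : W h + 1 ≤ 2 ^ (21 * z ^ 2) := by simpa [HtLE] using hWt h
    exact HtLE.natCast (le_trans (Nat.succ_le_succ (Nat.sub_le _ _)) h1)
  have hall := ((IsWSOS.sum (I := I) fun h _ => (hws h).C_mul (Nat.cast_nonneg (W h)) (hWt h)).add
    (IsWSOS.sum (I := I) fun h _ => IsWSOS.single (Nat.cast_nonneg (e h))
      ((het h).mono (by omega)) ((hr h).mono (by omega) (by omega)) fun _ => by
        have := hd h; omega)).mono_card (T' := 8 * (k * (H + 1))) (by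
          rw [hIc]; nlinarith)
  obtain ⟨c, p, hcp, hsum⟩ := hall
  have ha01 : ∀ h i, a h i = 0 ∨ a h i = 1 := fun h i => by
    by_cases h0 : a h i = 0
    · exact Or.inl h0
    · exact Or.inr (ha h i h0).1
  have hat : ∀ h i, HtLE (a h i) 1 := fun h i => by
    rcases ha01 h i with h0 | h0 <;> rw [h0]
    · exact HtLE.zero _
    · exact HtLE.one le_rfl
  have hann : ∀ h i, 0 ≤ a h i := fun h i => by
    rcases ha01 h i with h0 | h0 <;> rw [h0]
    norm_num
  have har : ∀ h i, C (a h i : ℝ) * toReal (r h) = C (a h i : ℝ) * f i := fun h i => by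
    by_cases h0 : a h i = 0
    · simp [h0]
    · rw [(ha h i h0).2]
  set A : Finset (Fin m) := I.biUnion fun h => Finset.univ.filter fun i => a h i ≠ 0 with hA
  set J : Finset (Fin n) := I.biUnion fun h => Finset.univ.filter fun j => q h j ≠ 0 with hJ
  have hAc : A.card ≤ z := (Finset.card_biUnion_le_card_mul _ _ 1 fun h _ => hac h).trans (by simpa using hIz)
  have hJc : J.card ≤ z := (Finset.card_biUnion_le_card_mul _ _ 1 fun h _ => hqc h).trans (by simpa using hIz)
  have hA0 : ∀ i, i ∉ A → ∀ h ∈ I, a h i = 0 := fun i hi h hh => by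
    by_contra hne
    exact hi (Finset.mem_biUnion.mpr ⟨h, hh, by simpa using hne⟩)
  have hJ0 : ∀ j, j ∉ J → ∀ h ∈ I, q h j = 0 := fun j hj h hh => by
    by_contra hne
    exact hj (Finset.mem_biUnion.mpr ⟨h, hh, by simpa using hne⟩)
  have hid : ∑ i, C (c i) * p i ^ 2 = ∑ i, ∑ h ∈ I, C (W h * a h i) * r h ^ 2
      + ∑ j, (∑ h ∈ I, C (W h : ℚ) * q h j) * domainPoly ρ j - r H ^ 2 := by
    rw [← hsum]
    have e1 : ∑ h ∈ I, C (W h : ℚ) * ∑ h', C (v h h' : ℚ) * r h' ^ 2 =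
        ∑ h ∈ I, C (V h : ℚ) * r h ^ 2 := by
      rw [Finset.sum_subset (Finset.subset_univ I)
        (f := fun h => C (V h : ℚ) * r h ^ 2) fun h _ hh => by rw [hV0 h hh]; simp]
      simp only [Finset.mul_sum]
      rw [Finset.sum_comm]
      refine Finset.sum_congr rfl fun h _ => ?_
      rw [hV]
      push_cast
      rw [map_sum, Finset.sum_mul]
      exact Finset.sum_congr rfl fun h' _ => by rw [C.map_mul, mul_assoc]
    have e2 : ∑ h ∈ I, C (W h : ℚ) * ∑ i, C (a h i) * r h ^ 2 =
        ∑ i, ∑ h ∈ I, C (W h * a h i) * r h ^ 2 := by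
      rw [Finset.sum_comm]
      refine Finset.sum_congr rfl fun h _ => ?_
      rw [Finset.mul_sum]
      exact Finset.sum_congr rfl fun i _ => by rw [C.map_mul, mul_assoc]
    have e3 : ∑ h ∈ I, C (W h : ℚ) * ∑ j, q h j * domainPoly ρ j =
        ∑ j, (∑ h ∈ I, C (W h : ℚ) * q h j) * domainPoly ρ j := by
      simp only [Finset.mul_sum, Finset.sum_mul, mul_assoc]
      rw [Finset.sum_comm]
    have e4 : ∑ h ∈ I, C (e h : ℚ) * r h ^ 2 = ∑ h ∈ I, C (W h : ℚ) * r h ^ 2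
        - ∑ h ∈ I, C (V h : ℚ) * r h ^ 2 - r H ^ 2 := by
      have : r H ^ 2 = ∑ h ∈ I, C (if h = H then 1 else 0 : ℚ) * r h ^ 2 := by
        rw [Finset.sum_eq_single H]
        · simp
        · intro h _ hne; simp [hne]
        · intro hH; exact absurd (Finset.mem_Iic.mpr le_rfl) hH
      rw [this, ← Finset.sum_sub_distrib, ← Finset.sum_sub_distrib]
      refine Finset.sum_congr rfl fun h _ => ?_
      rw [heq, map_sub, map_add]
      ring
    simp only [mul_sub, mul_add, Finset.sum_sub_distrib, Finset.sum_add_distrib]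
    rw [e1, e2, e3, e4]
    ring
  refine ⟨_, fun i => ∑ h ∈ I, W h * a h i, fun i => -∑ h ∈ I, C (W h * a h i) * r h,
    fun j => -∑ h ∈ I, C (W h : ℚ) * q h j, c, p, le_rfl,
    fun i => Finset.sum_nonneg fun h _ => mul_nonneg (Nat.cast_nonneg _) (hann h i),
    fun j => (hcp j).1, ?_, ?_, ?_, ?_, fun j => (hcp j).2.2.2, ?_⟩
  · intro i
    simp only [toReal, map_neg, map_sum, map_mul, map_C, eq_ratCast, Rat.cast_sum, Rat.cast_mul,
      neg_mul, Finset.sum_mul]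
    rw [neg_inj]
    exact Finset.sum_congr rfl fun h _ => by
      rw [mul_assoc, mul_assoc]; exact congrArg _ (har h i)
  · have h1 := congrArg toReal hid
    simp only [toReal, map_sub, map_add, map_sum, map_mul, map_pow, map_C, eq_ratCast] at h1
    simp only [toReal, map_neg, map_sum, map_mul, map_C, eq_ratCast, Rat.cast_sum, Rat.cast_mul,
      neg_mul, Finset.sum_neg_distrib]
    rw [h1]
    have e1 : ∀ j : Fin n, map (algebraMap ℚ ℝ) (domainPoly ρ j) = domainAxiom ρ j :=
      toReal_domainPoly ρ
    have e2 : ∀ i, ∑ h ∈ I, C ((W h : ℚ) : ℝ) * C (a h i : ℝ) * map (algebraMap ℚ ℝ) (r h) ^ 2 =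
        (∑ h ∈ I, C ((W h : ℚ) : ℝ) * C (a h i : ℝ)) * f i * f i := fun i => by
      rw [Finset.sum_mul, Finset.sum_mul]
      refine Finset.sum_congr rfl fun h _ => ?_
      have h2 : C (a h i : ℝ) * map (algebraMap ℚ ℝ) (r h) = C (a h i : ℝ) * f i := har h i
      by_cases h0 : a h i = 0
      · simp [h0]
      · have h3 : map (algebraMap ℚ ℝ) (r h) = f i := (ha h i h0).2
        rw [h3]; ring
    simp only [e1, e2]
    ring
  · intro i hi
    obtain ⟨h, hh, hne⟩ := Finset.exists_ne_zero_of_sum_ne_zero hi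
    rw [← (ha h i (right_ne_zero_of_mul hne)).2]
    exact (PCSoS.totalDegree_toReal_le _).trans (hd h)
  · intro j
    rw [neg_mul, totalDegree_neg, Finset.sum_mul]
    refine totalDegree_finsetSum_le fun h _ => ?_
    rw [mul_assoc]
    refine (totalDegree_mul _ _).trans ?_
    rw [totalDegree_C, zero_add]
    exact hqd h j
  · have hm₁ : (Finset.univ : Finset (Fin (8 * (k * (H + 1))))).card ≤ 8 * z ^ 2 := by
      rw [Finset.card_univ, Fintype.card_fin, pow_two]
      exact Nat.mul_le_mul_left _ (Nat.mul_le_mul (by omega) (hIc ▸ hIz))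
    refine proofBits_le (by omega) ?_ ?_ ?_ ?_ ?_
    · refine (Finset.sum_le_card_nsmul _ _ (2 * (22 * z ^ 3) + 3) fun i _ => ?_).trans
        (Nat.mul_le_mul_right _ ((Finset.card_le_card ?_).trans hAc))
      · refine ((HtLE.sum fun h _ => (hWt h).mul (hat h i)).mono ?_).ratBits_le
        refine (Nat.mul_le_mul_right _ hIz).trans ?_
        nlinarith
      · intro i hi
        by_contra hn
        refine (Finset.mem_filter.mp hi).2 (Finset.sum_eq_zero fun h hh => ?_)
        rw [hA0 i hn h hh, mul_zero]
    · refine sum_le_mul_of_support (I := A) (fun i hi => ?_) (fun i => ?_) hAc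
      · simp only
        rw [Finset.sum_eq_zero fun h hh => by rw [hA0 i hi h hh]; simp]
        simp [coeffBits]
      · refine PolyHtLE.coeffBits_le (PolyHtLE.mono (PolyHtLE.sum fun h _ =>
          (hr h).C_mul ((hWt h).mul (hat h i))).neg ?_ ?_)
        · rw [pow_two]; exact Nat.mul_le_mul_right _ hIz
        · refine (Nat.mul_le_mul_right _ hIz).trans ?_
          nlinarith
    · refine sum_le_mul_of_support (I := J) (fun j hj => ?_) (fun j => ?_) hJc
      · simp only
        rw [Finset.sum_eq_zero fun h hh => by rw [hJ0 j hj h hh, mul_zero]]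
        simp [coeffBits]
      · refine PolyHtLE.coeffBits_le (PolyHtLE.mono (PolyHtLE.sum fun h _ =>
          (hq h j).C_mul (hWt h)).neg ?_ ?_)
        · exact (Nat.mul_le_mul_right _ hIz).trans (le_of_eq (by ring))
        · exact (Nat.mul_le_mul_right _ hIz).trans (le_of_eq (by ring))
    · refine (Finset.sum_le_card_nsmul _ _ (2 * (81 * z ^ 2) + 3) fun j _ =>
        ((hcp j).2.1.mono (by omega)).ratBits_le).trans (Nat.mul_le_mul_right _ hm₁)
    · refine (Finset.sum_le_card_nsmul _ _ (2 * z * (2 * (81 * z ^ 2) + 3)) fun j _ =>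
        ((hcp j).2.2.1.mono le_rfl (by omega)).coeffBits_le).trans (Nat.mul_le_mul_right _ hm₁)

end PCSoS

theorem mainTheorem3 :
    ∃ (B : MvPolynomial (Fin 3) ℕ) (K : ℕ),
      ∀ (n m k L d S : ℕ) (_ : 1 ≤ k)
        (f : Fin m → MvPolynomial (Fin n) ℝ) (ρ : Fin (2 * k) → ℚ)
        (r : Fin L → MvPolynomial (Fin n) ℚ)
        (_ : PCSoS.IsPCDerivation f ρ (fun h => PCSoS.toReal (r h)))
        (_ : PCSoS.pcDegree r = d) (_ : PCSoS.pcSize r = S) (H : Fin L),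
        ∃ (m₁ : ℕ) (a : Fin m → ℚ) (g : Fin m → MvPolynomial (Fin n) ℚ)
          (q : Fin n → MvPolynomial (Fin n) ℚ) (c : Fin m₁ → ℚ)
          (p : Fin m₁ → MvPolynomial (Fin n) ℚ),
          m₁ ≤ K * (k * (H + 1)) ∧
          (∀ i, 0 ≤ a i) ∧ (∀ j, 0 ≤ c j) ∧
          (∀ i, PCSoS.toReal (g i) = -MvPolynomial.C (a i : ℝ) * f i) ∧
          ∑ i, (-MvPolynomial.C (a i : ℝ) * f i) * f i
              + ∑ j, PCSoS.toReal (q j) * PCSoS.domainAxiom ρ j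
              + ∑ j, MvPolynomial.C (c j : ℝ) * PCSoS.toReal (p j) ^ 2
            = -PCSoS.toReal (r H) ^ 2 ∧
          PCSoS.IsSoSProof (Sum.elim f (PCSoS.domainAxiom ρ)) (-PCSoS.toReal (r H) ^ 2)
            (2 * (d + k - 1))
            (fun j => MvPolynomial.C (Real.sqrt (c j : ℝ)) * PCSoS.toReal (p j))
            (Sum.elim (fun i => PCSoS.toReal (g i)) (fun j => PCSoS.toReal (q j))) ∧
          PCSoS.proofBits a g q c p ≤
            MvPolynomial.eval ![k, PCSoS.domainBits ρ, S] B := by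
  refine ⟨C 5000 * (X 0 + X 1 + X 2 + 1) ^ 7, 8, ?_⟩
  intro n m k L d S hk f ρ r hpc hd hS H
  have hsize : ∀ h, PCSoS.polySize (r h) ≤ S := fun h => by
    rw [← hS]
    exact Finset.single_le_sum (f := fun h => PCSoS.polySize (r h)) (fun _ _ => Nat.zero_le _)
      (Finset.mem_univ h)
  have hL : L ≤ S := by
    rw [← hS]
    calc L = (Finset.univ : Finset (Fin L)).card • 1 := by simp
      _ ≤ _ := Finset.card_nsmul_le_sum _ _ 1 fun h _ => Nat.le_add_left 1 _
  obtain ⟨m₁, a, g, q, c, p, hm₁, ha, hc, hg, hid, hfd, hqd, hpd, hbits⟩ :=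
    PCSoS.exists_sos_proof (d := d) (z := k + PCSoS.domainBits ρ + S + 1) hk hpc (by omega)
      (fun h => (PCSoS.polyHtLE_of_polySize (hsize h)).mono (by omega) (by omega))
      (fun h => hd ▸ Finset.le_sup (f := fun h => (r h).totalDegree) (Finset.mem_univ h))
      (by omega) H
  have hsq : ∀ j, (C (Real.sqrt (c j : ℝ)) * PCSoS.toReal (p j)) ^ 2 =
      C (c j : ℝ) * PCSoS.toReal (p j) ^ 2 := fun j => by
    rw [mul_pow, ← C.map_pow, Real.sq_sqrt (by exact_mod_cast hc j)]
  refine ⟨m₁, a, g, q, c, p, hm₁, ha, hc, hg, hid, ⟨?_, ?_, ?_⟩, ?_⟩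
  · rw [Fintype.sum_sum_type]
    simp only [Sum.elim_inl, Sum.elim_inr, hsq, hg]
    rw [← hid]
    ring
  · intro j
    rw [hsq]
    have : C (c j : ℝ) * PCSoS.toReal (p j) ^ 2 = PCSoS.toReal (C (c j) * p j ^ 2) := by
      simp [PCSoS.toReal]
    rw [this]
    exact (PCSoS.totalDegree_toReal_le _).trans (hpd j)
  · rintro (i | j)
    · simp only [Sum.elim_inl, hg]
      by_cases h0 : a i = 0
      · simp [h0]
      · have h1 := totalDegree_mul (-C (a i : ℝ) * f i) (f i)
        have h2 := totalDegree_mul (-C (a i : ℝ)) (f i)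
        rw [totalDegree_neg, totalDegree_C] at h2
        have h3 := hfd i h0
        omega
    · simp only [Sum.elim_inr]
      rw [← PCSoS.toReal_domainPoly]
      have : PCSoS.toReal (q j) * PCSoS.toReal (PCSoS.domainPoly ρ j) =
        PCSoS.toReal (q j * PCSoS.domainPoly ρ j) := by simp [PCSoS.toReal]
      rw [this]
      exact (PCSoS.totalDegree_toReal_le _).trans (hqd j)
  · simpa using hbits
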